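/- Let $\mathbb{F}_p$ be a field of prime order $p \ge 13$. A function $F\colon \mathbb{F}_p \to \mathbb{F}_p$ is called planar if for every non-zero $\alpha \in \mathbb{F}_p$ the map $x \mapsto F(x+\alpha)-F(x)-F(\alpha)$ is a permutation of $\mathbb{F}_p$. On a finite field $\mathbb{F}_q$ of characteristic $p$, the algebraic degree $\deg_{\mathrm{alg}}(F)$ of a non-zero function $F$ is the largest base-$p$ digit sum $s_p(i)$ over all $i$ for which $X^i$ has a non-zero coefficient in the unique polynomial of degree at most $q-1$ that interpolates $F$. If $F$ is a planar function on $\mathbb{F}_p$, then $\deg_{\mathrm{alg}}(F) = 2$. Consequently, a function $F$ on $\mathbb{F}_p$ is planar if and only if there are $a, b, c \in \mathbb{F}_p$ with $a \neq 0$ such that $F(x) = ax^2+bx+c$ for all $x \in \mathbb{F}_p$. -/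

import Mathlib

open Polynomial

/-- A function `F` on a finite field is planar if `x ↦ F (x + α) - F x - F α` is a permutation for
every non-zero `α`. -/
def IsPlanar {K : Type*} [Field K] (F : K → K) : Prop :=
  ∀ α : K, α ≠ 0 → Function.Bijective (fun x : K => F (x + α) - F x - F α)

/-- The sum of the digits of `e` in base `p`. -/
def digitSum (p e : ℕ) : ℕ := (Nat.digits p e).sum

open Classical in
/-- The unique interpolating polynomial of degree at most `q - 1` of a function on a field with
`q` elements. -/
noncomputable def interpPoly {K : Type*} [Field K] [Fintype K] (F : K → K) : K[X] :=
  Lagrange.interpolate Finset.univ id F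

theorem interpPoly_eval {K : Type*} [Field K] [Fintype K] (F : K → K) (x : K) :
    (interpPoly F).eval x = F x := by
  classical
  have h := Lagrange.eval_interpolate_at_node (s := (Finset.univ : Finset K)) (v := id) F
    (Set.injOn_id _) (Finset.mem_univ x)
  unfold interpPoly
  convert h
  rfl

theorem interpPoly_unique {K : Type*} [Field K] [Fintype K] (F : K → K) (P : K[X])
    (hdeg : P.degree < Fintype.card K) (heval : ∀ x, P.eval x = F x) : P = interpPoly F := by
  classical
  have h := Lagrange.eq_interpolate_of_eval_eq (s := (Finset.univ : Finset K)) (v := id) (f := P) F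
    (Set.injOn_id _) (by simpa using hdeg) (fun i _ => heval i)
  unfold interpPoly
  convert h

theorem interpPoly_degree_lt {K : Type*} [Field K] [Fintype K] (F : K → K) :
    (interpPoly F).degree < Fintype.card K := by
  classical
  have h := Lagrange.degree_interpolate_lt (s := (Finset.univ : Finset K)) (v := id) F
    (Set.injOn_id _)
  unfold interpPoly
  convert h
  exact Finset.card_univ.symm

/-- The algebraic degree of a function `F` on a finite field of characteristic `p`: the largest
base-`p` digit sum of an exponent `i` for which `X ^ i` has a non-zero coefficient in the
interpolating polynomial of `F` (by convention `0` if `F` is the zero function). -/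
noncomputable def algDegree {K : Type*} [Field K] [Fintype K] (F : K → K) : ℕ :=
  (interpPoly F).support.sup (digitSum (ringChar K))

/-! Planarity makes the differences `F (y + α) - F y` run once over `K` for each `α ≠ 0`, so `∑ (F x
- F y) ^ m` over all pairs does not depend on `F`. Expanding at `m = 2 * j` and inducting on `j`
kills the power sums of `F` below order `(p - 1) / 2` and determines their squares up to that order.
Planarity survives adding `c * x`, so these facts hold for all `c` at once; comparing coefficients
in `c` gives `∑ F x ^ a * x ^ b = 0` for small `a + b`. If `F` had degree `d ≥ 3`, dividing `p - 1 =
a * d + b` would give a polynomial `F ^ a * X ^ b` of degree exactly `p - 1`, whose values sum to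
minus its nonzero leading coefficient: a contradiction. -/

open Finset in
/-- The differences of the values of a planar function are equidistributed, expressed through
power sums. -/
theorem IsPlanar.sum_sub_pow {K : Type*} [Field K] [Fintype K] {F : K → K} (hF : IsPlanar F)
    (m : ℕ) : ∑ x, ∑ y, (F x - F y) ^ m = -∑ y : K, y ^ m := by
  classical
  have hshift : ∑ x, ∑ y, (F x - F y) ^ m = ∑ α : K, ∑ y, (F (y + α) - F y) ^ m := by
    rw [sum_comm, sum_comm (s := (univ : Finset K)) (f := fun α y => (F (y + α) - F y) ^ m)]
    exact sum_congr rfl fun y _ =>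
      (Equiv.sum_comp (Equiv.addLeft y) fun x => (F x - F y) ^ m).symm
  have hne : ∀ α ∈ (univ : Finset K).erase 0,
      ∑ y, (F (y + α) - F y) ^ m = ∑ y : K, y ^ m := by
    intro α hα
    have hb : Function.Bijective fun y => F (y + α) - F y := by
      have := (Equiv.addRight (F α)).bijective.comp (hF α (ne_of_mem_erase hα))
      simpa [Function.comp_def] using this
    exact hb.sum_comp fun y => y ^ m
  rw [hshift, ← add_sum_erase _ _ (mem_univ (0 : K)), sum_congr rfl hne]
  -- The term `α = 0` is `q * 0 ^ m`, which is zero in `K` even for `m = 0`; the other `q - 1 = -1`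
  -- terms agree.
  simp [card_erase_of_mem, Nat.cast_sub Fintype.card_pos]

/-- The difference operator annihilates additive maps. This supplies the free parameter `c` for the
mixed power sums. -/
theorem IsPlanar.add_linear {K : Type*} [Field K] {F : K → K} (hF : IsPlanar F) (c : K) :
    IsPlanar fun x => F x + c * x := by
  intro α hα
  convert hF α hα using 2
  ring

open Finset in
theorem sum_sub_pow_eq_sum_choose {K : Type*} [Field K] [Fintype K] (F : K → K) (m : ℕ) :
    ∑ x, ∑ y, (F x - F y) ^ m =
      ∑ i ∈ range (m + 1),
        (∑ x, F x ^ i) * (∑ y, F y ^ (m - i)) * ((-1) ^ (m - i) * (m.choose i : K)) := by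
  simp_rw [sub_eq_add_neg, add_pow, sum_mul_sum, sum_mul]
  rw [sum_comm (s := range (m + 1))]
  refine sum_congr rfl fun x _ => ?_
  rw [sum_comm]
  refine sum_congr rfl fun i _ => sum_congr rfl fun y _ => ?_
  rw [neg_pow]
  ring

/-- In a field of characteristic `p`, `m.choose i` is nonzero for `i ≤ m < p`. -/
theorem cast_choose_ne_zero {K : Type*} [Field K] {p : ℕ} [CharP K p] (hp : p.Prime) {m i : ℕ}
    (hm : m < p) (hi : i ≤ m) : (m.choose i : K) ≠ 0 := by
  rw [Ne, CharP.cast_eq_zero_iff K p]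
  intro h
  have := (Nat.choose_mul_factorial_mul_factorial hi) ▸
    ((h.mul_right i.factorial).mul_right (m - i).factorial)
  exact absurd ((hp.dvd_factorial).1 this) (not_le.2 hm)

open Finset in
/-- If the first `j` power sums of `F` vanish, then the difference power sum of order `2 * j` has
only its middle term. -/
theorem sum_sub_pow_two_mul {K : Type*} [Field K] [Fintype K] {F : K → K} {j : ℕ}
    (hj : ∀ i < j, ∑ x, F x ^ i = 0) :
    ∑ x, ∑ y, (F x - F y) ^ (2 * j) =
      (∑ x, F x ^ j) ^ 2 * ((-1) ^ j * ((2 * j).choose j : K)) := by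
  rw [sum_sub_pow_eq_sum_choose, sum_eq_single j]
  · rw [show 2 * j - j = j by lia]; ring
  · intro i hi hne
    rcases lt_or_gt_of_ne hne with h | h
    · rw [hj i h]; ring
    · rw [hj (2 * j - i) (by have := mem_range.1 hi; lia)]; ring
  · intro h; exact absurd (mem_range.2 (by lia)) h

/-- The power sums of order less than `(p - 1) / 2` of a planar function vanish. -/
theorem IsPlanar.sum_pow_eq_zero {K : Type*} [Field K] [Fintype K] {p : ℕ} [CharP K p]
    (hp : p.Prime) (hK : Fintype.card K = p) {F : K → K} (hF : IsPlanar F) (j : ℕ)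
    (hj : 2 * j < p - 1) : ∑ x, F x ^ j = 0 := by
  induction j using Nat.strong_induction_on with
  | _ j ih =>
    have h := sum_sub_pow_two_mul fun i hi => ih i hi (by lia)
    rw [hF.sum_sub_pow, FiniteField.sum_pow_lt_card_sub_one K _ (by rwa [hK]), neg_zero] at h
    have hc := cast_choose_ne_zero (K := K) hp (m := 2 * j) (i := j) (by lia) (by lia)
    simpa [hc] using h.symm

/-- The square of the power sum of order `j ≤ (p - 1) / 2` is the same for all planar functions. -/
theorem IsPlanar.sum_pow_sq {K : Type*} [Field K] [Fintype K] {p : ℕ} [CharP K p]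
    (hp : p.Prime) (hK : Fintype.card K = p) {F : K → K} (hF : IsPlanar F) (j : ℕ)
    (hj : 2 * j ≤ p - 1) :
    (∑ x, F x ^ j) ^ 2 = (-∑ y : K, y ^ (2 * j)) / ((-1) ^ j * ((2 * j).choose j : K)) := by
  have hc := cast_choose_ne_zero (K := K) hp (m := 2 * j) (i := j)
    (by have := hp.two_le; lia) (by lia)
  rw [← hF.sum_sub_pow, sum_sub_pow_two_mul fun i hi => hF.sum_pow_eq_zero hp hK i (by lia),
    mul_div_cancel_right₀]
  exact mul_ne_zero (pow_ne_zero _ (by simp)) hc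

open Finset in
/-- Mixed power sums of a planar function and the identity vanish in low order. -/
theorem IsPlanar.sum_pow_mul_pow {K : Type*} [Field K] [Fintype K] {p : ℕ} [CharP K p]
    (hp : p.Prime) (hK : Fintype.card K = p) {F : K → K} (hF : IsPlanar F) (a b : ℕ)
    (hab : 2 * (a + b) ≤ p - 1) (h : 0 < b ∨ 2 * (a + b) < p - 1) :
    ∑ x, F x ^ a * x ^ b = 0 := by
  have hp2 := hp.two_le
  set j := a + b with hj
  rcases Nat.eq_zero_or_pos b with rfl | hb
  · simpa using hF.sum_pow_eq_zero hp hK a (by lia)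
  set s : K := (-∑ y : K, y ^ (2 * j)) / ((-1) ^ j * ((2 * j).choose j : K)) with hs
  set Q : K[X] := ∑ x : K, (C (F x) + C x * X) ^ j with hQ
  have hQdeg : Q.natDegree ≤ j := by
    refine natDegree_sum_le_of_forall_le _ _ fun x _ => ?_
    refine natDegree_pow_le_of_le j (m := 1) ?_ |>.trans (by simp)
    compute_degree
  -- At `c`, `Q` is the power sum of the planar function `F x + c * x`, whose square is always `s`.
  -- Since `Q ^ 2` has degree at most `2 * j < p`, agreement at all `c` is an identity of
  -- polynomials.
  have hQsq : Q ^ 2 = C s := by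
    refine sub_eq_zero.1 (eq_zero_of_natDegree_lt_card_of_eval_eq_zero' _ univ ?_ ?_)
    · intro c _
      have := (hF.add_linear c).sum_pow_sq hp hK j hab
      rw [← hs] at this
      simp only [hQ, eval_sub, eval_pow, eval_finsetSum, eval_add, eval_mul, eval_C, eval_X]
      simp_rw [mul_comm c] at this
      rw [this, sub_self]
    · rw [card_univ, hK]
      refine (natDegree_sub_C.trans_le ((natDegree_pow_le_of_le 2 hQdeg).trans hab)).trans_lt ?_
      lia
  have hQ0 : Q.natDegree = 0 := by
    have := congrArg natDegree hQsq
    rw [natDegree_pow, natDegree_C] at this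
    lia
  have hcoeff : Q.coeff b = (∑ x, F x ^ a * x ^ b) * (j.choose b : K) := by
    rw [hQ, finsetSum_coeff, sum_mul]
    refine sum_congr rfl fun x _ => ?_
    rw [add_comm, add_pow, finsetSum_coeff, sum_eq_single b]
    · rw [show j - b = a by lia, mul_pow, ← C_pow, ← C_pow, ← C_eq_natCast, coeff_mul_C,
        coeff_mul_C, coeff_C_mul, coeff_X_pow_self]
      ring
    · intro i _ hi
      rw [mul_pow, ← C_pow, ← C_pow, ← C_eq_natCast, coeff_mul_C,
        coeff_mul_C, coeff_C_mul, coeff_X_pow, if_neg hi.symm]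
      ring
    · intro h; exact absurd (mem_range.2 (by lia)) h
  rw [coeff_eq_zero_of_natDegree_lt (by lia)] at hcoeff
  exact (mul_eq_zero.1 hcoeff.symm).resolve_right (cast_choose_ne_zero hp (by lia) (by lia))

open Finset in
/-- The sum of the values of a polynomial of degree at most `q - 1` over a field of `q` elements. -/
theorem sum_eval_eq_neg_coeff {K : Type*} [Field K] [Fintype K] (P : K[X])
    (hP : P.natDegree ≤ Fintype.card K - 1) :
    ∑ x, P.eval x = -P.coeff (Fintype.card K - 1) := by
  classical
  have hcard := Fintype.one_lt_card (α := K)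
  have hlast : ∑ x : K, x ^ (Fintype.card K - 1) = -1 := by
    rw [← add_sum_erase _ _ (mem_univ (0 : K)), sum_congr rfl fun x hx =>
      FiniteField.pow_card_sub_one_eq_one x (ne_of_mem_erase hx)]
    simp [card_erase_of_mem, Nat.cast_sub Fintype.card_pos,
      zero_pow (Nat.sub_ne_zero_of_lt hcard)]
  simp_rw [eval_eq_sum_range' (Nat.lt_succ_of_le hP)]
  rw [sum_comm, sum_range_succ, sum_eq_zero, zero_add, ← mul_sum, hlast, mul_neg_one]
  intro i hi
  rw [← mul_sum, FiniteField.sum_pow_lt_card_sub_one K _ (mem_range.1 hi), mul_zero]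

theorem IsPlanar.natDegree_interpPoly_le {K : Type*} [Field K] [Fintype K] {p : ℕ} [CharP K p]
    (hp : p.Prime) (hp5 : 5 ≤ p) (hK : Fintype.card K = p) {F : K → K} (hF : IsPlanar F) :
    (interpPoly F).natDegree ≤ 2 := by
  by_contra! hd
  set P := interpPoly F with hPdef
  set d := P.natDegree with hddef
  have hP0 : P ≠ 0 := by rintro h; simp [hddef, h] at hd
  have hdp : d < p := by
    rw [← hK]; exact (natDegree_lt_iff_degree_lt hP0).2 (interpPoly_degree_lt F)
  have hdm : (p - 1) / d * d + (p - 1) % d = p - 1 := Nat.div_add_mod' _ _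
  have hbd : (p - 1) % d < d := Nat.mod_lt _ (by lia)
  have ha : 0 < (p - 1) / d := Nat.div_pos (by lia) (by lia)
  set a := (p - 1) / d
  set b := (p - 1) % d
  -- Parity excludes `a = 1`, `b = d - 1`, where `p - 1 = 2 * d - 1` and the bound on `a + b` would
  -- fail.
  have hodd : ¬ 2 ∣ p := fun h => by have := (Nat.prime_dvd_prime_iff_eq Nat.prime_two hp).1 h; lia
  have hab : 2 * (a + b) ≤ p - 1 ∧ (0 < b ∨ 2 * (a + b) < p - 1) := by
    obtain ⟨e, he⟩ : ∃ e, d = e + 3 := ⟨d - 3, by lia⟩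
    rw [he] at hdm hbd
    rcases Nat.lt_or_ge a 2 with h1 | h2
    · obtain h1 : a = 1 := by lia
      rw [h1] at hdm ⊢
      lia
    · have : 2 * e ≤ a * e := Nat.mul_le_mul_right e h2
      have hae : a * (e + 3) = a * e + 3 * a := by ring
      lia
  have hsum := hF.sum_pow_mul_pow hp hK a b hab.1 hab.2
  have hdeg : (P ^ a * X ^ b).natDegree = p - 1 := by
    rw [natDegree_mul_X_pow _ (pow_ne_zero _ hP0), natDegree_pow, hdm]
  have heval := sum_eval_eq_neg_coeff (P ^ a * X ^ b) (by rw [hK, hdeg])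
  simp only [eval_mul, eval_pow, eval_X, hPdef, interpPoly_eval] at heval
  rw [hsum, ← hPdef, hK, ← hdeg] at heval
  have hlead : (P ^ a * X ^ b).leadingCoeff = 0 := neg_eq_zero.1 heval.symm
  exact mul_ne_zero (pow_ne_zero _ hP0) (pow_ne_zero _ X_ne_zero) (leadingCoeff_eq_zero.1 hlead)

theorem IsPlanar.exists_quadratic {K : Type*} [Field K] [Fintype K] {p : ℕ} [CharP K p]
    (hp : p.Prime) (hp5 : 5 ≤ p) (hK : Fintype.card K = p) {F : K → K} (hF : IsPlanar F) :
    ∃ a b c : K, a ≠ 0 ∧ ∀ x : K, F x = a * x ^ 2 + b * x + c := by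
  set P := interpPoly F with hP
  have hd : P.natDegree < 3 := Nat.lt_succ_of_le (hF.natDegree_interpPoly_le hp hp5 hK)
  have hquad : ∀ x : K, F x = P.coeff 2 * x ^ 2 + P.coeff 1 * x + P.coeff 0 := by
    intro x
    rw [← interpPoly_eval F x, ← hP, eval_eq_sum_range' hd]
    simp only [Finset.sum_range_succ, Finset.sum_range_zero]
    ring
  refine ⟨_, _, _, fun h0 => ?_, hquad⟩
  -- For affine `F` the difference map is constant.
  have := (hF 1 one_ne_zero).injective (a₁ := 0) (a₂ := 1) (by simp only [hquad, h0]; ring)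
  exact zero_ne_one this

theorem isPlanar_of_quadratic {K : Type*} [Field K] (h2 : (2 : K) ≠ 0) {F : K → K} {a b c : K}
    (ha : a ≠ 0) (hF : ∀ x, F x = a * x ^ 2 + b * x + c) : IsPlanar F := by
  intro α hα
  have h : 2 * a * α ≠ 0 := mul_ne_zero (mul_ne_zero h2 ha) hα
  -- The difference map is `x ↦ 2 * a * α * x - c`.
  convert (Equiv.subRight c).bijective.comp (mulLeft_bijective₀ _ h) using 2 with x
  simp only [Function.comp_apply, Equiv.subRight_apply, hF]
  ring

theorem algDegree_of_quadratic {K : Type*} [Field K] [Fintype K] {p : ℕ} [CharP K p]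
    (hp3 : 3 ≤ p) (hK : Fintype.card K = p) {F : K → K} {a b c : K}
    (ha : a ≠ 0) (hF : ∀ x, F x = a * x ^ 2 + b * x + c) : algDegree F = 2 := by
  have hdeg : (C a * X ^ 2 + C b * X + C c).degree = 2 := degree_quadratic ha
  have hint : C a * X ^ 2 + C b * X + C c = interpPoly F := by
    refine interpPoly_unique F _ ?_ fun x => by simp [hF]
    rw [hdeg, hK]
    exact_mod_cast hp3
  -- Exponents below `p` have a single base-`p` digit.
  have hdig : ∀ i ≤ 2, digitSum p i = i := by
    intro i hi
    rcases Nat.eq_zero_or_pos i with rfl | h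
    · simp [digitSum]
    · simp [digitSum, Nat.digits_of_lt p i h.ne' (by lia)]
  rw [algDegree, ringChar.eq K p, ← hint]
  refine le_antisymm (Finset.sup_le fun i hi => ?_) ?_
  · have hi2 : i ≤ 2 := by exact_mod_cast hdeg ▸ le_degree_of_mem_supp i hi
    rwa [hdig i hi2]
  · conv_lhs => rw [← hdig 2 le_rfl]
    refine Finset.le_sup (f := digitSum p) (mem_support_iff.2 ?_)
    simpa [coeff_X, coeff_C] using ha

theorem mainTheorem5 (p : ℕ) (hp : p.Prime) (hp13 : 13 ≤ p)
    {K : Type*} [Field K] [Fintype K] (hK : Fintype.card K = p) (F : K → K) :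
    (IsPlanar F → algDegree F = 2) ∧
      (IsPlanar F ↔ ∃ a b c : K, a ≠ 0 ∧ ∀ x : K, F x = a * x ^ 2 + b * x + c) := by
  have : Fact p.Prime := ⟨hp⟩
  have : CharP K p := charP_of_card_eq_prime hK
  refine ⟨fun hF => ?_, fun hF => hF.exists_quadratic hp (by lia) hK, ?_⟩
  · obtain ⟨a, b, c, ha, h⟩ := hF.exists_quadratic hp (by lia) hK
    exact algDegree_of_quadratic (by lia) hK ha h
  · rintro ⟨a, b, c, ha, h⟩
    refine isPlanar_of_quadratic (fun h2 => ?_) ha h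
    have h2' : ((2 : ℕ) : K) = 0 := by exact_mod_cast h2
    have := Nat.le_of_dvd two_pos ((CharP.cast_eq_zero_iff K p 2).1 h2')
    lia
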